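/- A (generalised) triangulation $\mathcal{T}$ consists of $n\ge 1$ tetrahedra, some or all of whose $4n$ triangular faces are affinely identified in pairs; it is assumed to be connected, and no edge may be identified with itself in reverse. A normal surface in $\mathcal{T}$ is a properly embedded surface that is transverse to every simplex and meets each tetrahedron in a finite disjoint collection of elementary discs (curvilinear triangles or quadrilaterals whose vertices lie on different edges of the tetrahedron, taken up to isotopies preserving every simplex). A splitting surface is a normal surface that meets each tetrahedron in precisely one elementary disc, this disc being a quadrilateral in every tetrahedron. Theorem. The problem "given a triangulation $\mathcal{T}$, does $\mathcal{T}$ contain a splitting surface?" has a polynomial-time algorithm. That is, there are a single Turing machine and a polynomial $p$ such that, for every $n$ and every $n$-tetrahedron triangulation $\mathcal{T}$, given as the list of its face identifications, the machine correctly decides within $p(n)$ steps whether $\mathcal{T}$ contains a splitting surface. -/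

import Mathlib

/-! ### The model tetrahedron, normal isotopies and elementary discs -/

/-- The model tetrahedron with vertices `0, 1, 2, 3`, in barycentric coordinates. -/
abbrev Tet : Type := stdSimplex ℝ (Fin 4)

namespace Tet

/-- The closed simplex of the tetrahedron spanned by a set `s` of vertices. -/
def simplex (s : Finset (Fin 4)) : Set Tet := {x | ∀ v, v ∉ s → x v = 0}

/-- A normal isotopy of the tetrahedron: an ambient isotopy that preserves every simplex. -/
structure NormalIsotopy where
  /-- The homeomorphism at each time. -/
  toHomeo : unitInterval → (Tet ≃ₜ Tet)
  continuous_toHomeo : Continuous fun p : unitInterval × Tet => toHomeo p.1 p.2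
  toHomeo_zero : toHomeo 0 = Homeomorph.refl Tet
  image_simplex : ∀ t s, toHomeo t '' simplex s = simplex s

/-- The seven types of elementary discs: `tri v` cuts off the vertex `v`, and `quad k` separates
the vertices `0` and `k + 1` from the other two vertices. -/
inductive DiscType
  | tri (v : Fin 4)
  | quad (k : Fin 3)

/-- The flat representative of each elementary disc type. -/
def flatDisc : DiscType → Set Tet
  | .tri v => {x | x v = 1 / 2}
  | .quad k => {x | x 0 + x k.succ = 1 / 2}

/-- `D` is an elementary disc of type `t`, i.e. it lies in the normal isotopy class of the flat
triangle or quadrilateral of type `t`. -/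
def IsElementaryDisc (t : DiscType) (D : Set Tet) : Prop :=
  ∃ h : NormalIsotopy, D = h.toHomeo 1 '' flatDisc t

end Tet

/-! ### Triangulations -/

/-- Gluing data for `n` tetrahedra. The face of a tetrahedron opposite its vertex `f` is called
face `f`. If `glue i f = some (j, σ)`, then face `f` of tetrahedron `i` is identified affinely with
face `σ f` of tetrahedron `j`, each vertex `v ≠ f` of the former being sent to the vertex `σ v`
of the latter; if `glue i f = none`, then face `f` of tetrahedron `i` is a boundary face. -/
abbrev GluingData (n : ℕ) : Type := Fin n → Fin 4 → Option (Fin n × Equiv.Perm (Fin 4))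

/-- One face identification carries the oriented edge from `e.2.1` to `e.2.2` of the tetrahedron
`e.1` to the oriented edge `e'`. -/
def GluingData.EdgeStep {n : ℕ} (g : GluingData n) (e e' : Fin n × Fin 4 × Fin 4) : Prop :=
  ∃ f σ, g e.1 f = some (e'.1, σ) ∧ e.2.1 ≠ f ∧ e.2.2 ≠ f ∧ e'.2 = (σ e.2.1, σ e.2.2)

/-- A connected generalised triangulation without invalid edges. -/
structure Triangulation where
  /-- The number of tetrahedra. -/
  n : ℕ
  n_pos : 0 < n
  /-- The face identifications. -/
  glue : GluingData n
  /-- The faces are identified in pairs: the identifications are symmetric ... -/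
  glue_symm : ∀ i f j σ, glue i f = some (j, σ) → glue j (σ f) = some (i, σ.symm)
  /-- ... and no face is identified with itself. -/
  glue_ne : ∀ i f j σ, glue i f = some (j, σ) → (j, σ f) ≠ (i, f)
  /-- Any two tetrahedra are joined by a chain of face identifications. -/
  connected : ∀ i j, Relation.ReflTransGen (fun a b => ∃ f σ, glue a f = some (b, σ)) i j
  /-- No edge is identified with itself in reverse. -/
  valid : ∀ i u v, u ≠ v → ¬ Relation.EqvGen glue.EdgeStep (i, u, v) (i, v, u)

namespace Triangulation

variable (T : Triangulation)

/-- A point of a face is identified with the corresponding point of the face glued to it. -/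
def PointStep (p q : Fin T.n × Tet) : Prop :=
  ∃ f σ, T.glue p.1 f = some (q.1, σ) ∧ p.2 f = 0 ∧ ∀ v, q.2 (σ v) = p.2 v

/-- The underlying space of a triangulation: the disjoint union of its tetrahedra, modulo the
equivalence relation generated by the face identifications. -/
abbrev Space : Type := Quot T.PointStep

/-- The part of `S` in the `i`-th tetrahedron (pulled back to the model tetrahedron, as distinct
points of one tetrahedron may be identified). -/
def slice (i : Fin T.n) (S : Set T.Space) : Set Tet := {x | Quot.mk T.PointStep (i, x) ∈ S}

/-! ### Normal surfaces -/

/-- A normal surface, as a subset of the underlying space: it meets each tetrahedron in a finite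
collection of pairwise disjoint elementary discs. As elementary discs are taken up to normal
isotopy, they are properly embedded in their tetrahedra and transverse to all simplices. Since `S`
is a subset of the glued space, the discs match along identified faces, and since no edge is
invalid, they fit together around each edge, so that `S` is a properly embedded surface. -/
def IsNormalSurface (S : Set T.Space) : Prop :=
  ∀ i, ∃ 𝒟 : Set (Set Tet), 𝒟.Finite ∧ 𝒟.PairwiseDisjoint id ∧
    (∀ D ∈ 𝒟, ∃ t, Tet.IsElementaryDisc t D) ∧ T.slice i S = ⋃₀ 𝒟

/-- A spanning central surface: a normal surface that meets each tetrahedron in precisely one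
elementary disc. -/
def IsSpanningCentralSurface (S : Set T.Space) : Prop :=
  T.IsNormalSurface S ∧ ∀ i, ∃ t, Tet.IsElementaryDisc t (T.slice i S)

/-- A splitting surface: a spanning central surface composed entirely of quadrilaterals. -/
def IsSplittingSurface (S : Set T.Space) : Prop :=
  T.IsSpanningCentralSurface S ∧ ∀ i, ∃ k, Tet.IsElementaryDisc (.quad k) (T.slice i S)

/-! ### Triangulations as words over a finite alphabet -/

/-- The finite input alphabet. -/
inductive Letter
  | face (f : Fin 4)
  | bit (b : Bool)
  | boundary
  | glued (σ : Equiv.Perm (Fin 4))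
  deriving DecidableEq, Fintype

/-- The index of a tetrahedron, in binary. -/
def encodeIndex (i : Fin T.n) : List Letter := (Computability.encodeNat i).map Letter.bit

/-- The line that describes face `f` of tetrahedron `i`: the letter `face f`, the index `i`, and
then either `boundary`, or `glued σ` followed by the index of the tetrahedron glued there. -/
def encodeFace (i : Fin T.n) (f : Fin 4) : List Letter :=
  Letter.face f :: T.encodeIndex i ++
    match T.glue i f with
    | none => [Letter.boundary]
    | some (j, σ) => Letter.glued σ :: T.encodeIndex j

/-- The encoding of a triangulation as a word: one line for each of the `4 n` tetrahedron faces. -/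
def encode : List Letter :=
  (List.finRange T.n).flatMap fun i => (List.finRange 4).flatMap fun f => T.encodeFace i f

end Triangulation

/-! A quadrilateral meets each face of its tetrahedron in one arc cutting off one vertex of that
face, and the three quadrilateral types cut off three different vertices. The type on one side of a
glued face therefore determines the type on the other side, by `quadImage`. As the triangulation is
connected, the type in one tetrahedron determines all the others, so only three candidates exist,
and each can be propagated and checked.

The topology enters only in `exists_isSplittingSurface_iff`. From a surface to types: a normal
isotopy preserves every edge, so the edges met by a disc reveal its type, and whether an edge is met
is the same on both sides of a gluing. From types to a surface: the flat quadrilaterals of matching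
types agree pointwise on glued faces, so their union descends to the quotient.

Propagation is done by repeated scans of the input word, keeping a list of known types ("facts"). A
scan that leaves the list unchanged and meets no contradiction certifies that the list is closed
under the gluings; any other scan adds a fact or fails. At most `n` facts fit, so at most `n + 1`
scans are needed for each candidate (`exists_converges`).

For the running time, the algorithm is written as a structured stack program with a step-counting
semantics (`Runs`), which compiles to a machine with the same step count plus one
(`Runs.machine_reachesWithin`). Each scan takes polynomial time (`exec_scanProg`), and `exec_main`
adds up the three attempts. -/

/-! ### Structured programs over stacks -/

/-- Structured programs over finitely many stacks and a finite set `σ` of internal states. -/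
inductive StackProg {K : Type} (Γ : K → Type) (σ : Type) : Type
  | push (k : K) (f : σ → Γ k)
  | pop (k : K) (f : σ → Option (Γ k) → σ)
  | load (f : σ → σ)
  | seq (p q : StackProg Γ σ)
  | cond (b : σ → Bool) (p q : StackProg Γ σ)
  | loop (b : σ → Bool) (p : StackProg Γ σ)

namespace StackProg

variable {K : Type} {Γ : K → Type} {σ : Type}

infixr:60 " ;; " => StackProg.seq

/-- The program that does nothing. -/
def skip : StackProg Γ σ := load id

/-- The control locations of a program. -/
def Label : StackProg Γ σ → Type
  | push _ _ | pop _ _ | load _ => Unit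
  | seq p q => p.Label ⊕ q.Label
  | cond _ p q => Option (p.Label ⊕ q.Label)
  | loop _ p => Option p.Label

instance Label.fintype : ∀ p : StackProg Γ σ, Fintype p.Label
  | push _ _ | pop _ _ | load _ => inferInstanceAs (Fintype Unit)
  | seq p q =>
    letI := Label.fintype p
    letI := Label.fintype q
    inferInstanceAs (Fintype (p.Label ⊕ q.Label))
  | cond _ p q =>
    letI := Label.fintype p
    letI := Label.fintype q
    inferInstanceAs (Fintype (Option (p.Label ⊕ q.Label)))
  | loop _ p =>
    letI := Label.fintype p
    inferInstanceAs (Fintype (Option p.Label))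

/-- The control location at which a program starts. -/
def entry : ∀ p : StackProg Γ σ, p.Label
  | push _ _ | pop _ _ | load _ => ()
  | seq p _ => Sum.inl p.entry
  | cond _ _ _ | loop _ _ => none

/-- The statement of the compiled machine at each control location of a program, given the
machine labels of its control locations and of its continuation. -/
def code {Λ : Type} :
    ∀ p : StackProg Γ σ, (p.Label → Λ) → Λ → p.Label → Turing.TM2.Stmt Γ Λ σ
  | push k f, _, next, _ => .push k f (.goto fun _ => next)
  | pop k f, _, next, _ => .pop k f (.goto fun _ => next)
  | load f, _, next, _ => .load f (.goto fun _ => next)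
  | seq p q, emb, _, .inl l => p.code (emb ∘ .inl) (emb (.inr q.entry)) l
  | seq _ q, emb, next, .inr l => q.code (emb ∘ .inr) next l
  | cond b p q, emb, _, none =>
    .branch b (.goto fun _ => emb (some (.inl p.entry))) (.goto fun _ => emb (some (.inr q.entry)))
  | cond _ p _, emb, next, some (.inl l) => p.code (emb ∘ some ∘ .inl) next l
  | cond _ _ q, emb, next, some (.inr l) => q.code (emb ∘ some ∘ .inr) next l
  | loop b p, emb, next, none =>
    .branch b (.goto fun _ => emb (some p.entry)) (.goto fun _ => next)
  | loop _ p, emb, _, some l => p.code (emb ∘ some) (emb none) l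

variable [DecidableEq K]

/-- `p.Runs v S v' S' t`: started with internal state `v` and stacks `S`, the program `p`
terminates within `t` steps with internal state `v'` and stacks `S'`. -/
inductive Runs : StackProg Γ σ → σ → (∀ k, List (Γ k)) → σ → (∀ k, List (Γ k)) → ℕ → Prop
  | push {k f v S} : Runs (.push k f) v S v (Function.update S k (f v :: S k)) 1
  | pop {k f v S} : Runs (.pop k f) v S (f v (S k).head?) (Function.update S k (S k).tail) 1
  | load {f v S} : Runs (.load f) v S (f v) S 1
  | seq {p q v S v' S' v'' S'' t t'} :
    Runs p v S v' S' t → Runs q v' S' v'' S'' t' → Runs (.seq p q) v S v'' S'' (t + t')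
  | cond_true {b p q v S v' S' t} : b v = true → Runs p v S v' S' t →
    Runs (.cond b p q) v S v' S' (t + 1)
  | cond_false {b p q v S v' S' t} : b v = false → Runs q v S v' S' t →
    Runs (.cond b p q) v S v' S' (t + 1)
  | loop_true {b p v S v' S' v'' S'' t t'} : b v = true → Runs p v S v' S' t →
    Runs (.loop b p) v' S' v'' S'' t' → Runs (.loop b p) v S v'' S'' (t + t' + 1)
  | loop_false {b p v S} : b v = false → Runs (.loop b p) v S v S 1
  | mono {p v S v' S' t t'} : Runs p v S v' S' t → t ≤ t' → Runs p v S v' S' t'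

/-- The machine reaches the configuration `b` from `a` within `t` steps. -/
def ReachesWithin {Λ : Type} (M : Λ → Turing.TM2.Stmt Γ Λ σ) (a b : Turing.TM2.Cfg Γ Λ σ)
    (t : ℕ) : Prop :=
  ∃ s ≤ t, (flip bind (Turing.TM2.step M))^[s] (some a) = some b

theorem ReachesWithin.trans {Λ : Type} {M : Λ → Turing.TM2.Stmt Γ Λ σ}
    {a b c : Turing.TM2.Cfg Γ Λ σ} {t t' : ℕ} (h : ReachesWithin M a b t)
    (h' : ReachesWithin M b c t') : ReachesWithin M a c (t + t') := by
  obtain ⟨s, hs, e⟩ := h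
  obtain ⟨s', hs', e'⟩ := h'
  exact ⟨s' + s, by omega, by rw [Function.iterate_add_apply, e, e']⟩

theorem ReachesWithin.single {Λ : Type} {M : Λ → Turing.TM2.Stmt Γ Λ σ} {l : Λ} {v : σ}
    {S : ∀ k, List (Γ k)} {b : Turing.TM2.Cfg Γ Λ σ} (h : Turing.TM2.stepAux (M l) v S = b) :
    ReachesWithin M ⟨some l, v, S⟩ b 1 :=
  ⟨1, le_rfl, congrArg some h⟩

theorem ReachesWithin.mono {Λ : Type} {M : Λ → Turing.TM2.Stmt Γ Λ σ}
    {a b : Turing.TM2.Cfg Γ Λ σ} {t t' : ℕ} (h : ReachesWithin M a b t) (ht : t ≤ t') :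
    ReachesWithin M a b t' := by
  obtain ⟨s, hs, e⟩ := h
  exact ⟨s, hs.trans ht, e⟩

/-- The compiled program simulates the structured program. -/
theorem Runs.reachesWithin {p : StackProg Γ σ} {v v' : σ} {S S' : ∀ k, List (Γ k)} {t : ℕ}
    (h : p.Runs v S v' S' t) {Λ : Type} (M : Λ → Turing.TM2.Stmt Γ Λ σ) (emb : p.Label → Λ)
    (next : Λ) (hM : ∀ l, M (emb l) = p.code emb next l) :
    ReachesWithin M ⟨some (emb p.entry), v, S⟩ ⟨some next, v', S'⟩ t := by
  -- The continuation has to vary: the first half of a sequence continues at the entry of the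
  -- second, and a loop body continues at the loop test.
  induction h generalizing next with
  | push => exact .single (by rw [hM]; rfl)
  | pop => exact .single (by rw [hM]; rfl)
  | load => exact .single (by rw [hM]; rfl)
  | seq _ _ ih₁ ih₂ =>
    exact (ih₁ (emb ∘ .inl) _ fun l => hM (.inl l)).trans
      (ih₂ (emb ∘ .inr) _ fun l => hM (.inr l))
  | @cond_true b p q v S _ _ t hb _ ih =>
    rw [add_comm t]
    refine (ReachesWithin.single (b := ⟨some (emb (some (.inl p.entry))), v, S⟩) ?_).trans
      (ih (emb ∘ some ∘ .inl) _ fun l => hM (some (.inl l)))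
    rw [hM]
    simp [entry, code, hb]
  | @cond_false b p q v S _ _ t hb _ ih =>
    rw [add_comm t]
    refine (ReachesWithin.single (b := ⟨some (emb (some (.inr q.entry))), v, S⟩) ?_).trans
      (ih (emb ∘ some ∘ .inr) _ fun l => hM (some (.inr l)))
    rw [hM]
    simp [entry, code, hb]
  | @loop_true b p v S _ _ _ _ t t' hb _ _ ih₁ ih₂ =>
    rw [add_comm (t + t')]
    refine (ReachesWithin.single (b := ⟨some (emb (some p.entry)), v, S⟩) ?_).trans
      ((ih₁ (emb ∘ some) _ fun l => hM (some l)).trans (ih₂ emb _ hM))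
    rw [hM]
    simp [entry, code, hb]
  | loop_false hb =>
    refine ReachesWithin.single ?_
    rw [hM]
    simp [entry, code, hb]
  | mono _ hle ih => exact (ih emb next hM).mono hle

/-- The machine that runs a program and halts. -/
def machine (p : StackProg Γ σ) : Option p.Label → Turing.TM2.Stmt Γ (Option p.Label) σ
  | none => .halt
  | some l => p.code some none l

/-- The additional step executes `halt`. -/
theorem Runs.machine_reachesWithin {p : StackProg Γ σ} {v v' : σ} {S S' : ∀ k, List (Γ k)} {t : ℕ}
    (h : p.Runs v S v' S' t) :
    ReachesWithin p.machine ⟨some (some p.entry), v, S⟩ ⟨none, v', S'⟩ (t + 1) :=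
  (h.reachesWithin p.machine some none fun _ => rfl).trans (.single rfl)

end StackProg

/-! ### Quadrilateral types and face identifications -/

namespace Tet

/-- The quadrilateral of type `k` separates the vertices `u` and `v`. -/
def Separates (k : Fin 3) (u v : Fin 4) : Prop :=
  (u = 0 ∨ u = k.succ) ↔ ¬ (v = 0 ∨ v = k.succ)

instance (k : Fin 3) (u v : Fin 4) : Decidable (Separates k u v) :=
  inferInstanceAs (Decidable (_ ↔ _))

/-- The quadrilateral type `k'` is the image of `k` under `σ`. -/
def QuadMap (σ : Equiv.Perm (Fin 4)) (k k' : Fin 3) : Prop :=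
  ∀ u v, Separates k u v ↔ Separates k' (σ u) (σ v)

instance (σ : Equiv.Perm (Fin 4)) (k k' : Fin 3) : Decidable (QuadMap σ k k') :=
  inferInstanceAs (Decidable (∀ _ _, _))

/-- The image of a quadrilateral type under a permutation of the vertices. -/
def quadImage (σ : Equiv.Perm (Fin 4)) (k : Fin 3) : Fin 3 :=
  if QuadMap σ k 0 then 0 else if QuadMap σ k 1 then 1 else 2

-- Permutations of the vertices permute the three splittings into two pairs. In particular the
-- default branch `2` of `quadImage` is correct.
set_option maxRecDepth 100000 in
theorem quadMap_quadImage : ∀ (σ : Equiv.Perm (Fin 4)) (k : Fin 3),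
    QuadMap σ k (quadImage σ k) := by
  decide

/-- The trace of a quadrilateral on a single face determines its type. -/
theorem eq_of_separates_iff : ∀ (f : Fin 4) (k k' : Fin 3),
    (∀ u v, u ≠ f → v ≠ f → (Separates k u v ↔ Separates k' u v)) → k = k' := by
  decide

/-- Both `k'` and `quadImage σ k` have the same trace on face `σ f`, and one face determines the
type. -/
theorem eq_quadImage {σ : Equiv.Perm (Fin 4)} {f : Fin 4} {k k' : Fin 3}
    (h : ∀ u v, u ≠ f → v ≠ f → (Separates k u v ↔ Separates k' (σ u) (σ v))) :
    k' = quadImage σ k := by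
  refine eq_of_separates_iff (σ f) _ _ fun u v hu hv => ?_
  have := h (σ.symm u) (σ.symm v) (fun e => hu (by simp [← e])) (fun e => hv (by simp [← e]))
  rw [quadMap_quadImage σ k] at this
  simpa using this.symm

end Tet

/-! ### Splitting surfaces as consistent choices of quadrilateral types -/

namespace Tet

theorem sum_coord (x : Tet) : x 0 + x 1 + x 2 + x 3 = 1 := by
  have h : ∑ v, x v = 1 := x.2.2
  rwa [Fin.sum_univ_four] at h

theorem flat_inter_edge_nonempty_iff (k : Fin 3) (u v : Fin 4) :
    (flatDisc (.quad k) ∩ simplex {u, v}).Nonempty ↔ Separates k u v := by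
  constructor
  · rintro ⟨x, hx, hs⟩
    have hsum := sum_coord x
    change x 0 + x k.succ = 1 / 2 at hx
    by_contra h
    have h0 : ∀ w, w ≠ u → w ≠ v → x w = 0 := fun w hu hv => hs w (by simp [hu, hv])
    have e0 := h0 0
    have e1 := h0 1
    have e2 := h0 2
    have e3 := h0 3
    fin_cases k <;> fin_cases u <;> fin_cases v <;> first
      -- On an edge that is not separated, the coordinates in the flat equation sum to 0 or 1, never
      -- to 1/2.
      | exact h (by decide)
      | (simp at e0 e1 e2 e3 hx; linarith)
  · intro h
    have huv : u ≠ v := by rintro rfl; exact iff_not_self h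
    -- The witness is the midpoint of the edge.
    refine ⟨⟨fun w => if w = u ∨ w = v then 1 / 2 else 0, fun w => by positivity, ?_⟩, ?_, ?_⟩
    · revert huv
      fin_cases u <;> fin_cases v <;> simp [Fin.sum_univ_four] <;> norm_num
    · change (if _ then _ else _ : ℝ) + (if _ then _ else _) = _
      revert h
      fin_cases k <;> fin_cases u <;> fin_cases v <;> simp [Separates]
    · intro w hw
      exact if_neg (by simpa using hw)

/-- An elementary quadrilateral meets exactly those edges whose endpoints it separates. -/
theorem IsElementaryDisc.inter_edge_nonempty_iff {k : Fin 3} {D : Set Tet}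
    (hD : IsElementaryDisc (.quad k) D) (u v : Fin 4) :
    (D ∩ simplex {u, v}).Nonempty ↔ Separates k u v := by
  obtain ⟨h, rfl⟩ := hD
  rw [← flat_inter_edge_nonempty_iff, ← h.image_simplex 1 {u, v},
    ← Set.image_inter (h.toHomeo 1).injective, Set.image_nonempty]
  rw [h.image_simplex]

theorem isElementaryDisc_flatDisc (t : DiscType) : IsElementaryDisc t (flatDisc t) :=
  ⟨⟨fun _ => Homeomorph.refl Tet, continuous_snd, rfl, fun _ _ => by simp⟩, by simp⟩

/-- The affine symmetry of the tetrahedron given by a permutation of the vertices. -/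
def permute (σ : Equiv.Perm (Fin 4)) (x : Tet) : Tet :=
  ⟨fun v => x (σ.symm v), fun _ => x.2.1 _, (Equiv.sum_comp σ.symm fun v => x v).trans x.2.2⟩

theorem permute_apply (σ : Equiv.Perm (Fin 4)) (x : Tet) (v : Fin 4) :
    permute σ x (σ v) = x v :=
  congrArg x.1 (σ.symm_apply_apply v)

/-- Since the coordinates sum to 1, one pair of them sums to 1/2 exactly when the complementary pair
does. The flat quadrilateral thus depends only on the splitting into pairs, not on which pair
contains 0. -/
theorem mem_flatDisc_iff_of_quadMap {σ : Equiv.Perm (Fin 4)} {k k' : Fin 3} (h : QuadMap σ k k')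
    {x y : Tet} (hxy : ∀ v, y (σ v) = x v) :
    x ∈ flatDisc (.quad k) ↔ y ∈ flatDisc (.quad k') := by
  have hsum := sum_coord x
  obtain ⟨a, ha⟩ := σ.surjective 0
  obtain ⟨b, hb⟩ := σ.surjective k'.succ
  have hab : a ≠ b := by
    rintro rfl
    exact Fin.succ_ne_zero _ (hb.symm.trans ha)
  have hs : ¬ Separates k a b := by
    rw [h a b, ha, hb]
    simp [Separates]
  change x 0 + x k.succ = 1 / 2 ↔ y 0 + y k'.succ = 1 / 2
  rw [← hb, hxy, show y 0 = x a by rw [← ha, hxy]]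
  clear ha hb hxy h
  fin_cases k <;> fin_cases a <;> fin_cases b <;> first
    | exact absurd rfl hab
    | exact absurd (by decide) hs
    | (simp only [Fin.succ, Fin.isValue, Fin.reduceFinMk, Fin.zero_eta, Fin.mk_one, Nat.reduceAdd]
       try (constructor <;> intro e <;> linarith))

end Tet

namespace Triangulation

open Tet

variable (T : Triangulation)

/-- A choice of one quadrilateral type in each tetrahedron such that the quadrilaterals match
along the identified faces. -/
def IsQuadColouring (k : Fin T.n → Fin 3) : Prop :=
  ∀ i f j σ, T.glue i f = some (j, σ) → k j = quadImage σ (k i)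

variable {T}

/-- The edge lies in face `f`, so each of its points is identified with its image under the gluing,
and a subset of the quotient contains both or neither. -/
theorem slice_inter_edge_nonempty_iff (S : Set T.Space) {i j : Fin T.n} {f : Fin 4}
    {σ : Equiv.Perm (Fin 4)} (hg : T.glue i f = some (j, σ)) {u v : Fin 4} (hu : u ≠ f)
    (hv : v ≠ f) :
    (T.slice i S ∩ simplex {u, v}).Nonempty ↔ (T.slice j S ∩ simplex {σ u, σ v}).Nonempty := by
  have key : ∀ x y : Tet, x f = 0 → (∀ w, y (σ w) = x w) → (x ∈ T.slice i S ↔ y ∈ T.slice j S) := by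
    intro x y hx hxy
    have : Quot.mk T.PointStep (i, x) = Quot.mk T.PointStep (j, y) :=
      Quot.sound ⟨f, σ, hg, hx, hxy⟩
    rw [slice, slice, Set.mem_ofPred_eq, Set.mem_ofPred_eq, this]
  constructor
  · rintro ⟨x, hx, hs⟩
    have hf : x f = 0 := hs f (by simp [hu.symm, hv.symm])
    refine ⟨permute σ x, (key x _ hf (permute_apply σ x)).1 hx, fun w hw => ?_⟩
    rw [← σ.apply_symm_apply w, permute_apply]
    refine hs _ fun hmem => hw ?_
    simp only [Finset.mem_insert, Finset.mem_singleton, Equiv.symm_apply_eq] at hmem ⊢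
    exact hmem
  · rintro ⟨y, hy, hs⟩
    have hxy : ∀ w, y (σ w) = permute σ.symm y w := fun w => rfl
    have hz : ∀ w, w ∉ ({u, v} : Finset (Fin 4)) → permute σ.symm y w = 0 := fun w hw => by
      rw [← hxy]
      exact hs _ (by simpa using hw)
    exact ⟨permute σ.symm y, (key _ y (hz f (by simp [hu.symm, hv.symm])) hxy).2 hy, hz⟩

/-- A triangulation contains a splitting surface if and only if one can choose matching
quadrilateral types. -/
theorem exists_isSplittingSurface_iff :
    (∃ S : Set T.Space, T.IsSplittingSurface S) ↔ ∃ k, T.IsQuadColouring k := by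
  constructor
  · rintro ⟨S, -, hS⟩
    choose k hk using hS
    refine ⟨k, fun i f j σ hg => eq_quadImage (f := f) fun u v hu hv => ?_⟩
    rw [← (hk i).inter_edge_nonempty_iff, ← (hk j).inter_edge_nonempty_iff]
    exact slice_inter_edge_nonempty_iff S hg hu hv
  · rintro ⟨k, hk⟩
    -- Membership in the flat quadrilaterals respects the identifications, which makes their union a
    -- subset of the quotient whose slices are exactly these quadrilaterals.
    have compat : ∀ p q, T.PointStep p q →
        (p.2 ∈ flatDisc (.quad (k p.1))) = (q.2 ∈ flatDisc (.quad (k q.1))) := by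
      rintro p q ⟨f, σ, hg, -, hpq⟩
      refine propext (mem_flatDisc_iff_of_quadMap ?_ hpq)
      rw [hk _ _ _ _ hg]
      exact quadMap_quadImage _ _
    let S : Set T.Space := {q | Quot.lift _ compat q}
    have hS : ∀ i, T.slice i S = flatDisc (.quad (k i)) := fun i => rfl
    have hd : ∀ i, IsElementaryDisc (.quad (k i)) (T.slice i S) := fun i => by
      rw [hS]
      exact isElementaryDisc_flatDisc _
    exact ⟨S, ⟨fun i => ⟨{T.slice i S}, Set.finite_singleton _, Set.pairwiseDisjoint_singleton _ _,
      by simpa using ⟨_, hd i⟩, by simp⟩, fun i => ⟨_, hd i⟩⟩, fun i => ⟨_, hd i⟩⟩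

end Triangulation

/-! ### Propagation of quadrilateral types through a triangulation -/

namespace Triangulation

open Tet

/-- A fact records the quadrilateral type of the tetrahedron whose index has the given bits. -/
abbrev Fact : Type := List Bool × Fin 3

/-- The quadrilateral type recorded for a given index. -/
def lookup (w : List Bool) : List Fact → Option (Fin 3)
  | [] => none
  | p :: F => (lookup w F).or (if p.1 = w then some p.2 else none)

/-- The number of letters needed to write down a list of facts. -/
def factsSize (F : List Fact) : ℕ := (F.map fun p => p.1.length + 1).sum

theorem mem_of_lookup_eq_some {w : List Bool} {k : Fin 3} {F : List Fact}
    (h : lookup w F = some k) : (w, k) ∈ F := by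
  induction F with
  | nil => simp [lookup] at h
  | cons p F ih =>
    rw [lookup, Option.or_eq_some_iff] at h
    obtain h | ⟨-, h⟩ := h
    · exact List.mem_cons_of_mem _ (ih h)
    · rw [Option.ite_none_right_eq_some] at h
      obtain ⟨rfl, h⟩ := h
      rw [Option.some.injEq] at h
      subst h
      exact List.mem_cons_self

theorem notMem_of_lookup_eq_none {w : List Bool} {F : List Fact} (h : lookup w F = none) :
    w ∉ F.map Prod.fst := by
  induction F with
  | nil => simp
  | cons p F ih =>
    rw [lookup, Option.or_eq_none_iff] at h
    have := h.2
    simp only [List.map_cons, List.mem_cons, not_or]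
    exact ⟨fun e => by simp [e] at this, ih h.1⟩

/-- The state of a scan of the input. -/
@[ext]
structure ScanState where
  /-- The bits of the index that is being read, the last one first. -/
  word : List Bool
  /-- The quadrilateral type that the next index must have. -/
  pend : Option (Fin 3)
  /-- The facts found so far. -/
  facts : List Fact
  /-- Whether a new fact was found. -/
  changed : Bool
  /-- Whether a contradiction was found. -/
  failed : Bool

namespace ScanState

/-- An index has been read completely, and is followed by the letter `a` or the end of the
input. -/
def finish (a : Option Letter) (s : ScanState) : ScanState where
  word := []
  pend := match a with
    | some (.glued σ) => (lookup s.word s.facts).map (quadImage σ)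
    | _ => none
  facts := match s.pend, lookup s.word s.facts with
    | some k, none => (s.word, k) :: s.facts
    | _, _ => s.facts
  changed := s.changed || (s.pend.isSome && (lookup s.word s.facts).isNone)
  failed := s.failed ||
    (s.pend.isSome && (lookup s.word s.facts).isSome && lookup s.word s.facts != s.pend)

/-- A letter of the input is read. -/
def step (s : ScanState) : Letter → ScanState
  | .bit b => { s with word := b :: s.word }
  | a => s.finish (some a)

theorem foldl_step_bits (s : ScanState) (l : List Bool) :
    (l.map Letter.bit).foldl step s = { s with word := l.reverse ++ s.word } := by
  induction l generalizing s with
  | nil => rfl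
  | cons b l ih => simp [ih, step]

theorem word_length_step_le (s : ScanState) (a : Letter) :
    (s.step a).word.length ≤ s.word.length + 1 := by
  cases a <;> simp [step, finish]

theorem factsSize_finish_le (s : ScanState) (a : Option Letter) :
    factsSize (s.finish a).facts ≤ factsSize s.facts + (s.word.length + 1) := by
  simp only [finish]
  split
  · simp [factsSize]
    omega
  · omega

theorem factsSize_step_le (s : ScanState) (a : Letter) :
    factsSize (s.step a).facts ≤ factsSize s.facts + (s.word.length + 1) := by
  cases a
  case bit => simp [step]
  all_goals exact factsSize_finish_le s _

end ScanState

/-- One scan of the input. -/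
def scan (w : List Letter) (F : List Fact) : ScanState :=
  (w.foldl ScanState.step ⟨[], none, F, false, false⟩).finish none

/-- Repeated scans of the input `w`, starting from the facts `F`, end after `r` scans in the state
`s`, and there are always at most `B` letters of facts before a scan. -/
inductive Converges (w : List Letter) (B : ℕ) : List Fact → ScanState → ℕ → Prop
  | last {F} : factsSize F ≤ B → ((scan w F).changed && !(scan w F).failed) = false →
    Converges w B F (scan w F) 1
  | next {F s r} : factsSize F ≤ B → ((scan w F).changed && !(scan w F).failed) = true →
    Converges w B (scan w F).facts s r → Converges w B F s (r + 1)

variable (T : Triangulation)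

/-- The bits of an index, the last one first. -/
def key (i : Fin T.n) : List Bool := (Computability.encodeNat i).reverse

theorem key_injective : Function.Injective T.key := fun i j h => by
  have := congrArg Computability.decodeNat (List.reverse_injective h)
  simpa [Fin.ext_iff] using this

theorem length_encodePosNum_le (p : PosNum) : (Computability.encodePosNum p).length ≤ (p : ℕ) := by
  induction p with
  | one => simp [Computability.encodePosNum]
  | bit1 p ih => simp [Computability.encodePosNum]; omega
  | bit0 p ih =>
    have : 0 < (p : ℕ) := PosNum.cast_pos p
    simp [Computability.encodePosNum]
    omega

/-- The length is really logarithmic; this crude bound is enough for a polynomial. -/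
theorem length_encodeNat_le (m : ℕ) : (Computability.encodeNat m).length ≤ m := by
  rw [Computability.encodeNat]
  conv_rhs => rw [← Num.to_of_nat m]
  cases (m : Num) with
  | zero => simp [Computability.encodeNum]
  | pos p => exact length_encodePosNum_le p

theorem length_key_le (i : Fin T.n) : (T.key i).length ≤ T.n := by
  rw [key, List.length_reverse]
  exact (length_encodeNat_le _).trans i.2.le

/-- This is why `([], c)` is the initial fact for candidate type `c`. -/
theorem key_zero : T.key ⟨0, T.n_pos⟩ = [] := by
  simp [key, Computability.encodeNat, Computability.encodeNum]

/-- All faces of all tetrahedra. -/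
def faces : List (Fin T.n × Fin 4) :=
  (List.finRange T.n).flatMap fun i => (List.finRange 4).map fun f => (i, f)

theorem mem_faces (p : Fin T.n × Fin 4) : p ∈ T.faces := by
  simp [faces]

theorem length_faces : T.faces.length = T.n * 4 := by
  simp [faces, List.length_flatMap]

theorem encode_eq : T.encode = T.faces.flatMap fun p => T.encodeFace p.1 p.2 := by
  simp [encode, faces, List.flatMap_assoc, List.flatMap_map]

theorem length_encodeFace_le (i : Fin T.n) (f : Fin 4) :
    (T.encodeFace i f).length ≤ 2 * T.n + 2 := by
  have h : ∀ j, (T.encodeIndex j).length ≤ T.n := fun j => by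
    rw [encodeIndex, List.length_map]
    exact (length_encodeNat_le _).trans j.2.le
  have hi := h i
  rw [encodeFace]
  rcases T.glue i f with _ | ⟨j, σ⟩
  · simp; omega
  · have := h j
    simp; omega

theorem length_encode_le : T.encode.length ≤ T.n * 4 * (2 * T.n + 2) := by
  rw [encode_eq, List.length_flatMap, ← length_faces]
  refine (List.sum_le_card_nsmul _ (2 * T.n + 2) ?_).trans (by simp)
  simp only [List.mem_map]
  rintro _ ⟨p, -, rfl⟩
  exact T.length_encodeFace_le _ _

/-- The effect of scanning the line of one face. -/
def scanFace (s : ScanState) (p : Fin T.n × Fin 4) : ScanState :=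
  match T.glue p.1 p.2 with
  | none => s
  | some (j, σ) =>
    match lookup (T.key p.1) s.facts with
    | none => s
    | some k =>
      match lookup (T.key j) s.facts with
      | none => { s with facts := (T.key j, quadImage σ k) :: s.facts, changed := true }
      | some k' => { s with failed := s.failed || k' != quadImage σ k }

variable {T}

/-- The letter `face` that opens a line also terminates the last index of the preceding line. Lines
are therefore cut just after their first letter, and `finish none` stands for the terminator. -/
theorem finish_foldl_tail_encodeFace {s : ScanState} (hw : s.word = []) (hp : s.pend = none)
    (p : Fin T.n × Fin 4) :
    ((T.encodeFace p.1 p.2).tail.foldl ScanState.step s).finish none = T.scanFace s p := by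
  rw [encodeFace, scanFace, List.cons_append, List.tail_cons, List.foldl_append, encodeIndex,
    ScanState.foldl_step_bits]
  rcases T.glue p.1 p.2 with _ | ⟨j, σ⟩
  · ext <;> simp [ScanState.step, ScanState.finish, hw, hp]
  · simp only [List.foldl_cons, encodeIndex, ScanState.foldl_step_bits]
    have e : (Computability.encodeNat p.1).reverse = T.key p.1 := rfl
    have e' : (Computability.encodeNat j).reverse = T.key j := rfl
    rcases h : lookup (T.key p.1) s.facts with _ | k
    · ext1 <;> simp [ScanState.step, ScanState.finish, hw, hp, e, h]
    · dsimp only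
      rcases h' : lookup (T.key j) s.facts with _ | k'
      · ext1 <;> simp [ScanState.step, ScanState.finish, hw, hp, e, e', h, h']
      · ext1 <;> simp [ScanState.step, ScanState.finish, hw, hp, e, e', h, h']
        rfl

theorem finish_foldl_faces (l : List (Fin T.n × Fin 4)) (s : ScanState) :
    ((l.flatMap fun p => T.encodeFace p.1 p.2).foldl ScanState.step s).finish none =
      l.foldl T.scanFace (s.finish none) := by
  induction l generalizing s with
  | nil => rfl
  | cons p l ih =>
    have hs : s.step (.face p.2) = s.finish none := rfl
    rw [List.flatMap_cons, List.foldl_append, ih, List.foldl_cons,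
      ← finish_foldl_tail_encodeFace rfl rfl, ← hs]
    rfl

theorem scan_encode (F : List Fact) :
    scan T.encode F = T.faces.foldl T.scanFace ⟨[], none, F, false, false⟩ := by
  rw [scan, encode_eq, finish_foldl_faces]
  congr 1

/-- The facts are a partial choice of quadrilateral types, with type `c` in the first tetrahedron,
that agrees with every matching choice of types that has type `c` there. -/
structure IsPartialColouring (c : Fin 3) (F : List Fact) : Prop where
  lookup_nil : lookup [] F = some c
  keys : ∃ L : List (Fin T.n), L.Nodup ∧ F.map Prod.fst = L.map T.key
  sound : ∀ k, T.IsQuadColouring k → k ⟨0, T.n_pos⟩ = c → ∀ i k', (T.key i, k') ∈ F → k' = k i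

theorem isPartialColouring_singleton (c : Fin 3) : T.IsPartialColouring c [([], c)] where
  lookup_nil := by simp [lookup]
  keys := ⟨[⟨0, T.n_pos⟩], by simp, by simp [key_zero]⟩
  sound k _ hc i k' h := by
    simp only [List.mem_singleton, Prod.mk.injEq] at h
    rw [h.2, ← hc, T.key_injective (h.1.trans T.key_zero.symm)]

theorem IsPartialColouring.length_le {c : Fin 3} {F : List Fact} (h : T.IsPartialColouring c F) :
    F.length ≤ T.n := by
  obtain ⟨L, hL, e⟩ := h.keys
  have := congrArg List.length e
  simp only [List.length_map] at this
  rw [this]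
  simpa using hL.length_le_card

theorem IsPartialColouring.factsSize_le {c : Fin 3} {F : List Fact}
    (h : T.IsPartialColouring c F) : factsSize F ≤ T.n * (T.n + 1) := by
  obtain ⟨L, hL, e⟩ := h.keys
  have hs : factsSize F = ((F.map Prod.fst).map fun w => w.length + 1).sum := by
    simp [factsSize, Function.comp_def]
  rw [hs, e]
  refine (List.sum_le_card_nsmul _ (T.n + 1) ?_).trans ?_
  · simp only [List.map_map, List.mem_map]
    rintro _ ⟨i, -, rfl⟩
    exact Nat.succ_le_succ (T.length_key_le i)
  · have := hL.length_le_card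
    simp only [List.length_map, smul_eq_mul]
    exact Nat.mul_le_mul_right _ (by simpa using this)

/-- A new fact is forced by the matching condition from an older one, and its key is new because its
lookup failed. -/
theorem IsPartialColouring.scanFace {c : Fin 3} {s : ScanState}
    (h : T.IsPartialColouring c s.facts) (p : Fin T.n × Fin 4) :
    T.IsPartialColouring c (T.scanFace s p).facts := by
  unfold Triangulation.scanFace
  split
  · exact h
  · rename_i j σ hg
    split
    · exact h
    · rename_i k hk
      split
      · rename_i hj
        obtain ⟨L, hL, e⟩ := h.keys
        refine ⟨by simp [lookup, h.lookup_nil],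
          ⟨j :: L, List.nodup_cons.2 ⟨fun hm => ?_, hL⟩, by simp [e]⟩,
          fun col hcol hc i k' hm => ?_⟩
        · refine notMem_of_lookup_eq_none hj ?_
          rw [e]
          exact List.mem_map_of_mem hm
        · obtain hm | hm := List.mem_cons.1 hm
          · rw [Prod.mk.injEq] at hm
            rw [hm.2, T.key_injective hm.1, hcol _ _ _ _ hg,
              h.sound col hcol hc _ _ (mem_of_lookup_eq_some hk)]
          · exact h.sound col hcol hc i k' hm
      · exact h

theorem IsPartialColouring.foldl_scanFace {c : Fin 3} {s : ScanState}
    (h : T.IsPartialColouring c s.facts) (l : List (Fin T.n × Fin 4)) :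
    T.IsPartialColouring c (l.foldl T.scanFace s).facts := by
  induction l generalizing s with
  | nil => exact h
  | cons p l ih => exact ih (h.scanFace p)

/-- Both facts compared at a face agree with the given colouring, which matches there, so no
contradiction can arise. -/
theorem scanFace_failed {c : Fin 3} {s : ScanState} (h : T.IsPartialColouring c s.facts)
    {col : Fin T.n → Fin 3} (hcol : T.IsQuadColouring col) (hc : col ⟨0, T.n_pos⟩ = c)
    (p : Fin T.n × Fin 4) : (T.scanFace s p).failed = s.failed := by
  unfold Triangulation.scanFace
  split
  · rfl
  · rename_i j σ hg
    split
    · rfl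
    · rename_i k hk
      split
      · rfl
      · rename_i k' hk'
        have h1 := h.sound col hcol hc _ _ (mem_of_lookup_eq_some hk)
        have h2 := h.sound col hcol hc _ _ (mem_of_lookup_eq_some hk')
        simp [h2, h1, hcol _ _ _ _ hg]

theorem foldl_scanFace_failed {c : Fin 3} {s : ScanState} (h : T.IsPartialColouring c s.facts)
    {col : Fin T.n → Fin 3} (hcol : T.IsQuadColouring col) (hc : col ⟨0, T.n_pos⟩ = c)
    (l : List (Fin T.n × Fin 4)) : (l.foldl T.scanFace s).failed = s.failed := by
  induction l generalizing s with
  | nil => rfl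
  | cons p l ih => rw [List.foldl_cons, ih (h.scanFace p), scanFace_failed h hcol hc]

/-- The dichotomy behind termination: either the facts stay put, and then absence of failure
certifies closure under this gluing, or there is one more fact. -/
theorem changed_scanFace (s : ScanState) (p : Fin T.n × Fin 4) :
    (T.scanFace s p = { s with failed := (T.scanFace s p).failed } ∧
      ((T.scanFace s p).failed = false → s.failed = false ∧
        ∀ j σ k, T.glue p.1 p.2 = some (j, σ) → lookup (T.key p.1) s.facts = some k →
        lookup (T.key j) s.facts = some (quadImage σ k))) ∨
    ((T.scanFace s p).changed = true ∧ (T.scanFace s p).facts.length = s.facts.length + 1) := by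
  unfold Triangulation.scanFace
  split
  · simp_all
  · rename_i j σ hg
    split
    · rename_i hk
      left
      simp [hk]
    · rename_i k hk
      split
      · right
        simp
      · rename_i k' hk'
        left
        simp only [Bool.or_eq_false_iff, bne_eq_false_iff_eq, true_and]
        rintro ⟨hs, rfl⟩
        refine ⟨hs, fun j' σ' k' hg' hk'' => ?_⟩
        rw [hg] at hg'
        rw [hk] at hk''
        cases hg'
        cases hk''
        exact hk'

theorem foldl_scanFace_spec (l : List (Fin T.n × Fin 4)) (s : ScanState) :
    ((l.foldl T.scanFace s).facts = s.facts ∧ (l.foldl T.scanFace s).changed = s.changed ∧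
      ((l.foldl T.scanFace s).failed = false → s.failed = false ∧
        ∀ p ∈ l, ∀ j σ k, T.glue p.1 p.2 = some (j, σ) → lookup (T.key p.1) s.facts = some k →
        lookup (T.key j) s.facts = some (quadImage σ k))) ∨
    ((l.foldl T.scanFace s).changed = true ∧
      s.facts.length < (l.foldl T.scanFace s).facts.length) := by
  induction l generalizing s with
  | nil => simp
  | cons p l ih =>
    rw [List.foldl_cons]
    rcases changed_scanFace s p with ⟨h, h'⟩ | ⟨h, h'⟩
    · have hf : (T.scanFace s p).facts = s.facts := by rw [h]
      have hch : (T.scanFace s p).changed = s.changed := by rw [h]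
      have ih := ih (T.scanFace s p)
      rw [hf, hch] at ih
      refine ih.imp_left fun ⟨a, b, d⟩ => ⟨a, b, fun hx => ?_⟩
      obtain ⟨d1, d2⟩ := d hx
      obtain ⟨e1, e2⟩ := h' d1
      exact ⟨e1, List.forall_mem_cons.2 ⟨e2, d2⟩⟩
    · rcases ih (T.scanFace s p) with ⟨a, b, -⟩ | ⟨a, b⟩
      · right
        rw [a, b, h, h']
        simp
      · exact .inr ⟨a, by omega⟩

/-- Facts that are closed under the face identifications define a matching choice of types. -/
theorem exists_isQuadColouring_of_closed {c : Fin 3} {F : List Fact} (h0 : lookup [] F = some c)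
    (h : ∀ i f j σ k, T.glue i f = some (j, σ) → lookup (T.key i) F = some k →
      lookup (T.key j) F = some (quadImage σ k)) :
    ∃ col, T.IsQuadColouring col ∧ col ⟨0, T.n_pos⟩ = c := by
  -- Closure carries the type of the first tetrahedron along chains of gluings, which reach
  -- everything by connectedness.
  have total : ∀ i, ∃ k, lookup (T.key i) F = some k := by
    intro i
    induction T.connected ⟨0, T.n_pos⟩ i with
    | refl => exact ⟨c, by rw [key_zero, h0]⟩
    | tail _ hstep ih =>
      obtain ⟨f, σ, hg⟩ := hstep
      obtain ⟨k, hk⟩ := ih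
      exact ⟨_, h _ _ _ _ _ hg hk⟩
  choose col hcol using total
  refine ⟨col, fun i f j σ hg => ?_, ?_⟩
  · have := h _ _ _ _ _ hg (hcol i)
    rw [hcol j] at this
    exact Option.some.inj this
  · have := hcol ⟨0, T.n_pos⟩
    rw [key_zero, h0] at this
    exact (Option.some.inj this).symm

/-- Repeated scans decide whether there is a matching choice of types with type `c` in the first
tetrahedron. -/
theorem exists_converges {c : Fin 3} (m : ℕ) {F : List Fact} (hF : T.IsPartialColouring c F)
    (hm : T.n ≤ F.length + m) :
    ∃ s r, Converges T.encode (T.n * (T.n + 1)) F s r ∧ r ≤ m + 1 ∧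
      (s.failed = false ↔ ∃ col, T.IsQuadColouring col ∧ col ⟨0, T.n_pos⟩ = c) := by
  -- Here `m` bounds the number of facts still missing; each scan that calls for another one lowers
  -- it.
  induction m using Nat.strong_induction_on generalizing F with | _ m ih
  have hs := scan_encode (T := T) F
  have hspec := foldl_scanFace_spec T.faces ⟨[], none, F, false, false⟩
  have hF' := IsPartialColouring.foldl_scanFace (s := ⟨[], none, F, false, false⟩) hF T.faces
  have hsound : (∃ col, T.IsQuadColouring col ∧ col ⟨0, T.n_pos⟩ = c) →
      (scan T.encode F).failed = false := fun ⟨col, hcol, hc⟩ => by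
    rw [hs]
    exact foldl_scanFace_failed (s := ⟨[], none, F, false, false⟩) hF hcol hc T.faces
  rw [← hs] at hspec hF'
  cases hb : (scan T.encode F).changed && !(scan T.encode F).failed with
  | false =>
    refine ⟨_, _, .last hF.factsSize_le hb, by omega, fun hf => ?_, hsound⟩
    rw [hf, Bool.not_false, Bool.and_true] at hb
    rcases hspec with ⟨-, -, h⟩ | ⟨h, -⟩
    · exact exists_isQuadColouring_of_closed hF.lookup_nil
        fun i f j σ k hg => (h hf).2 (i, f) (T.mem_faces _) j σ k hg
    · rw [hb] at h
      cases h
  | true =>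
    have hlt : F.length < (scan T.encode F).facts.length := by
      rcases hspec with ⟨-, h, -⟩ | ⟨-, h⟩
      · rw [h] at hb
        cases hb
      · exact h
    have hle := hF'.length_le
    obtain _ | m := m
    · omega
    obtain ⟨s, r, hc, hr, h⟩ := ih m (by omega) hF' (by omega)
    exact ⟨s, r + 1, .next hF.factsSize_le hb hc, by omega, h⟩

end Triangulation

/-! ### A machine that propagates quadrilateral types -/

namespace SplittingMachine

open Triangulation Tet StackProg

/-- The stacks of the machine. -/
inductive Stack
  | input | scanned | word | saved | facts | seen | output
  deriving DecidableEq

instance : Fintype Stack where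
  elems := {.input, .scanned, .word, .saved, .facts, .seen, .output}
  complete k := by cases k <;> decide

/-- The alphabet of each stack. -/
def Alphabet : Stack → Type
  | .input | .scanned => Letter
  | .word | .saved | .output => Bool
  | .facts | .seen => Bool ⊕ Fin 3

/-- The internal states of the machine. -/
@[ext]
structure Reg where
  /-- The letter last read from the input. -/
  letter : Option Letter
  /-- The bit last read from an index. -/
  bit : Option Bool
  /-- The symbol last read from the list of facts. -/
  sym : Option (Bool ⊕ Fin 3)
  /-- Whether the fact that is being read agrees with the current index so far. -/
  eq : Bool
  /-- The type recorded for the current index. -/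
  found : Option (Fin 3)
  /-- The type that the next index must have. -/
  pend : Option (Fin 3)
  /-- Whether a new fact was found. -/
  changed : Bool
  /-- Whether a contradiction was found. -/
  failed : Bool
  /-- Whether one of the attempts succeeded. -/
  answer : Bool

noncomputable instance : Fintype Reg :=
  Fintype.ofInjective (β := (Option Letter × Option Bool × Option (Bool ⊕ Fin 3) × Bool) ×
      Option (Fin 3) × Option (Fin 3) × Bool × Bool × Bool)
    (fun v => ((v.letter, v.bit, v.sym, v.eq), v.found, v.pend, v.changed, v.failed, v.answer))
    fun v w h => by
      simp only [Prod.mk.injEq] at h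
      ext1 <;> simp [h]

/-- The contents of the stacks. -/
structure Store where
  /-- The unread input. -/
  input : List Letter
  /-- The input that has been read, reversed. -/
  scanned : List Letter
  /-- The current index. -/
  word : List Bool
  /-- The part of the current index that has been compared, reversed. -/
  saved : List Bool
  /-- The facts. -/
  facts : List (Bool ⊕ Fin 3)
  /-- The facts that have been read, reversed. -/
  seen : List (Bool ⊕ Fin 3)
  /-- The output. -/
  output : List Bool

namespace Store

/-- The stacks of the machine as a family. -/
def stk (s : Store) : ∀ k, List (Alphabet k)
  | .input => s.input
  | .scanned => s.scanned
  | .word => s.word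
  | .saved => s.saved
  | .facts => s.facts
  | .seen => s.seen
  | .output => s.output

/-- Replace the contents of one stack. -/
def set (s : Store) : ∀ k, List (Alphabet k) → Store
  | .input, l => { s with input := l }
  | .scanned, l => { s with scanned := l }
  | .word, l => { s with word := l }
  | .saved, l => { s with saved := l }
  | .facts, l => { s with facts := l }
  | .seen, l => { s with seen := l }
  | .output, l => { s with output := l }

theorem stk_set (s : Store) (k : Stack) (l : List (Alphabet k)) :
    (s.set k l).stk = Function.update s.stk k l := by
  funext k'
  cases k <;> cases k' <;> rfl

theorem set_stk (s : Store) (k : Stack) : s.set k (s.stk k) = s := by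
  cases k <;> rfl

end Store

/-- The programs of the machine. -/
abbrev Prog : Type := StackProg Alphabet Reg

/-- `Exec p v s v' s' t`: the program `p` leads from the internal state `v` and the stacks `s` to
the internal state `v'` and the stacks `s'` within `t` steps. -/
def Exec (p : Prog) (v : Reg) (s : Store) (v' : Reg) (s' : Store) (t : ℕ) : Prop :=
  p.Runs v s.stk v' s'.stk t

namespace Exec

theorem push {k : Stack} {f : Reg → Alphabet k} {v : Reg} {s : Store} :
    Exec (.push k f) v s v (s.set k (f v :: s.stk k)) 1 := by
  rw [Exec, Store.stk_set]
  exact .push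

theorem pop {k : Stack} {f : Reg → Option (Alphabet k) → Reg} {v : Reg} {s : Store} :
    Exec (.pop k f) v s (f v (s.stk k).head?) (s.set k (s.stk k).tail) 1 := by
  rw [Exec, Store.stk_set]
  exact .pop

theorem load {f : Reg → Reg} {v : Reg} {s : Store} : Exec (.load f) v s (f v) s 1 :=
  Runs.load

theorem skip {v : Reg} {s : Store} : Exec .skip v s v s 1 :=
  Runs.load

variable {p q : Prog} {b : Reg → Bool} {v v' v'' : Reg} {s s' s'' : Store} {t t' : ℕ}

theorem seq (h : Exec p v s v' s' t) (h' : Exec q v' s' v'' s'' t') :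
    Exec (p ;; q) v s v'' s'' (t + t') :=
  Runs.seq h h'

theorem mono (h : Exec p v s v' s' t) (ht : t ≤ t') : Exec p v s v' s' t' :=
  Runs.mono h ht

theorem congr {w w' : Reg} {r r' : Store} (h : Exec p v s v' s' t) (hv : v = w) (hs : s = r)
    (hv' : v' = w') (hs' : s' = r') : Exec p w r w' r' t := by
  rwa [← hv, ← hs, ← hv', ← hs']

theorem cond_true (hb : b v = true) (h : Exec p v s v' s' t) :
    Exec (.cond b p q) v s v' s' (t + 1) :=
  Runs.cond_true hb h

theorem cond_false (hb : b v = false) (h : Exec q v s v' s' t) :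
    Exec (.cond b p q) v s v' s' (t + 1) :=
  Runs.cond_false hb h

theorem loop_true (hb : b v = true) (h : Exec p v s v' s' t)
    (h' : Exec (.loop b p) v' s' v'' s'' t') : Exec (.loop b p) v s v'' s'' (t + t' + 1) :=
  Runs.loop_true hb h h'

theorem loop_false (hb : b v = false) : Exec (.loop b p) v s v s 1 :=
  Runs.loop_false hb

end Exec

/-- Run `body` for each symbol that is popped from the stack `k`. -/
def drain (k : Stack) (f : Reg → Option (Alphabet k) → Reg) (b : Reg → Bool) (body : Prog) : Prog :=
  .pop k f ;; .loop b (body ;; .pop k f)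

/-- `U p r` and `S p r` are the loop invariant, with `p` the processed symbols (last one first) and
`r` the remaining ones. Each symbol costs the body, a pop and a test; the additional 2 is the first
pop and the last test. -/
theorem Exec.drain {k : Stack} {f : Reg → Option (Alphabet k) → Reg} {b : Reg → Bool} {body : Prog}
    {c : ℕ} {v : Reg} (U : List (Alphabet k) → List (Alphabet k) → Reg)
    (S : List (Alphabet k) → List (Alphabet k) → Store) (l : List (Alphabet k))
    (hS : ∀ p r, (S p r).stk k = r) (hv : f v l.head? = U [] l)
    (hnil : ∀ p, b (U p []) = false) (hcons : ∀ p a r, b (U p (a :: r)) = true)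
    (hbody : ∀ p a r, p.reverse ++ a :: r = l → ∃ v',
      Exec body (U p (a :: r)) ((S p (a :: r)).set k r) v' (S (a :: p) r) c ∧
        f v' r.head? = U (a :: p) r) :
    Exec (drain k f b body) v (S [] l) (U l.reverse []) (S l.reverse [])
      ((c + 2) * l.length + 2) := by
  -- At the loop test the head of `r` has already been popped into the internal state, so the stack
  -- holds only `r.tail`.
  have hloop : ∀ r p, p.reverse ++ r = l → Exec (.loop b (body ;; .pop k f)) (U p r)
      ((S p r).set k r.tail) (U l.reverse []) (S l.reverse []) ((c + 2) * r.length + 1) := by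
    intro r
    induction r with
    | nil =>
      intro p hp
      obtain rfl : p = l.reverse := by simp [← hp]
      have : (S l.reverse []).set k [] = S l.reverse [] := by
        conv_rhs => rw [← Store.set_stk (S l.reverse []) k, hS]
      rw [List.tail_nil, this]
      exact (loop_false (hnil _)).mono (by omega)
    | cons a r ih =>
      intro p hp
      obtain ⟨v', h, hv'⟩ := hbody p a r hp
      have hpop := Exec.pop (f := f) (v := v') (s := S (a :: p) r)
      rw [hS, hv'] at hpop
      exact (loop_true (hcons _ _ _) (h.seq hpop) (ih (a :: p) (by simp [← hp]))).mono
        (by simp only [List.length_cons]; ring_nf; omega)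
  have hpop := Exec.pop (f := f) (v := v) (s := S [] l)
  rw [hS, hv] at hpop
  exact (hpop.seq (hloop l [] rfl)).mono (by omega)

/-! #### Moving and erasing the contents of stacks -/

/-- Store the bit that was read. -/
def setBit (v : Reg) (o : Option Bool) : Reg := { v with bit := o }

/-- Store the symbol that was read. -/
def setSym (v : Reg) (o : Option (Bool ⊕ Fin 3)) : Reg := { v with sym := o }

/-- Store the letter that was read. -/
def setLetter (v : Reg) (o : Option Letter) : Reg := { v with letter := o }

/-- Move the saved bits back to the current index. -/
def restoreWord : Prog :=
  drain .saved setBit (fun v => v.bit.isSome) (.push .word fun v => v.bit.getD false)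

/-- Move the current index to the saved bits. -/
def saveWord : Prog :=
  drain .word setBit (fun v => v.bit.isSome) (.push .saved fun v => v.bit.getD false)

/-- Move the saved bits to the facts. -/
def recordWord : Prog :=
  drain .saved setBit (fun v => v.bit.isSome) (.push .facts fun v => .inl (v.bit.getD false))

/-- Erase the current index. -/
def clearWord : Prog :=
  drain .word setBit (fun v => v.bit.isSome) .skip

/-- Move the facts that have been read back. -/
def restoreFacts : Prog :=
  drain .seen setSym (fun v => v.sym.isSome) (.push .facts fun v => v.sym.getD (.inl false))

/-- Erase the facts. -/
def clearFacts : Prog :=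
  drain .facts setSym (fun v => v.sym.isSome) .skip

/-- Move the input that has been read back. -/
def restoreInput : Prog :=
  drain .scanned setLetter (fun v => v.letter.isSome)
    (.push .input fun v => v.letter.getD .boundary)

/-- Erase the input. -/
def clearInput : Prog :=
  drain .input setLetter (fun v => v.letter.isSome) .skip

section Moves

variable (v : Reg) (s : Store)

theorem exec_restoreWord : Exec restoreWord v s { v with bit := none }
    { s with saved := [], word := s.saved.reverse ++ s.word } (3 * s.saved.length + 2) :=
  Exec.drain (k := .saved) (fun _ r => { v with bit := r.head? })
    (fun p r => { s with saved := r, word := List.append p s.word }) s.saved (fun _ _ => rfl) rfl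
    (fun _ => rfl) (fun _ _ _ => rfl) fun _ _ _ _ => ⟨_, Exec.push, rfl⟩

theorem exec_saveWord : Exec saveWord v s { v with bit := none }
    { s with word := [], saved := s.word.reverse ++ s.saved } (3 * s.word.length + 2) :=
  Exec.drain (k := .word) (fun _ r => { v with bit := r.head? })
    (fun p r => { s with word := r, saved := List.append p s.saved }) s.word (fun _ _ => rfl) rfl
    (fun _ => rfl) (fun _ _ _ => rfl) fun _ _ _ _ => ⟨_, Exec.push, rfl⟩

theorem exec_recordWord : Exec recordWord v s { v with bit := none }
    { s with saved := [], facts := s.saved.reverse.map .inl ++ s.facts }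
    (3 * s.saved.length + 2) :=
  Exec.drain (k := .saved) (fun _ r => { v with bit := r.head? })
    (fun p r => { s with saved := r, facts := List.map .inl (show List Bool from p) ++ s.facts })
    s.saved (fun _ _ => rfl) rfl
    (fun _ => rfl) (fun _ _ _ => rfl) fun _ _ _ _ => ⟨_, Exec.push, rfl⟩

theorem exec_clearWord : Exec clearWord v s { v with bit := none } { s with word := [] }
    (3 * s.word.length + 2) :=
  Exec.drain (k := .word) (fun _ r => { v with bit := r.head? })
    (fun _ r => { s with word := r }) s.word (fun _ _ => rfl) rfl
    (fun _ => rfl) (fun _ _ _ => rfl) fun _ _ _ _ => ⟨_, Exec.skip, rfl⟩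

theorem exec_restoreFacts : Exec restoreFacts v s { v with sym := none }
    { s with seen := [], facts := s.seen.reverse ++ s.facts } (3 * s.seen.length + 2) :=
  Exec.drain (k := .seen) (fun _ r => { v with sym := r.head? })
    (fun p r => { s with seen := r, facts := List.append p s.facts }) s.seen (fun _ _ => rfl) rfl
    (fun _ => rfl) (fun _ _ _ => rfl) fun _ _ _ _ => ⟨_, Exec.push, rfl⟩

theorem exec_clearFacts : Exec clearFacts v s { v with sym := none } { s with facts := [] }
    (3 * s.facts.length + 2) :=
  Exec.drain (k := .facts) (fun _ r => { v with sym := r.head? })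
    (fun _ r => { s with facts := r }) s.facts (fun _ _ => rfl) rfl
    (fun _ => rfl) (fun _ _ _ => rfl) fun _ _ _ _ => ⟨_, Exec.skip, rfl⟩

theorem exec_restoreInput : Exec restoreInput v s { v with letter := none }
    { s with scanned := [], input := s.scanned.reverse ++ s.input }
    (3 * s.scanned.length + 2) :=
  Exec.drain (k := .scanned) (fun _ r => { v with letter := r.head? })
    (fun p r => { s with scanned := r, input := List.append p s.input })
    s.scanned (fun _ _ => rfl) rfl
    (fun _ => rfl) (fun _ _ _ => rfl) fun _ _ _ _ => ⟨_, Exec.push, rfl⟩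

theorem exec_clearInput : Exec clearInput v s { v with letter := none } { s with input := [] }
    (3 * s.input.length + 2) :=
  Exec.drain (k := .input) (fun _ r => { v with letter := r.head? })
    (fun _ r => { s with input := r }) s.input (fun _ _ => rfl) rfl
    (fun _ => rfl) (fun _ _ _ => rfl) fun _ _ _ _ => ⟨_, Exec.skip, rfl⟩

end Moves

end SplittingMachine

namespace SplittingMachine

open Triangulation Tet StackProg

/-! #### Looking up the current index -/

/-- Compare one symbol of the facts with the current index. -/
def judge (v : Reg) : Reg :=
  match v.sym with
  | some (.inl b) => { v with eq := v.eq && v.bit == some b }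
  | some (.inr k) =>
    { v with eq := true, found := if v.eq && v.bit == none then some k else v.found }
  | none => v

/-- Whether the symbol that was read is a quadrilateral type. -/
def isType (v : Reg) : Bool :=
  match v.sym with
  | some (.inr _) => true
  | _ => false

/-- Process one symbol of the facts. -/
def compare : Prog :=
  .push .seen (fun v => v.sym.getD (.inl false)) ;; .pop .word setBit ;; .load judge ;;
  .cond (fun v => v.bit.isSome) (.push .saved fun v => v.bit.getD false) .skip ;;
  .cond isType restoreWord .skip

/-- Look up the current index in the facts. -/
def findType : Prog :=
  .load (fun v => { v with bit := none, eq := true, found := none }) ;;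
  drain .facts setSym (fun v => v.sym.isSome) compare ;; restoreFacts

/-- The symbols of a list of facts. -/
def encodeFacts (F : List Fact) : List (Bool ⊕ Fin 3) :=
  F.flatMap fun p => p.1.map .inl ++ [.inr p.2]

theorem length_encodeFacts (F : List Fact) : (encodeFacts F).length = factsSize F := by
  simp [encodeFacts, factsSize, List.length_flatMap]

/-- The loop of `findType` after a symbol was read. -/
def compareLoop : Prog :=
  .loop (fun v => v.sym.isSome) (compare ;; .pop .facts setSym)

/-- One index bit is popped per bit of the fact and kept in `saved`, so `hw` is invariant. The
closing type symbol is a match if all bits agreed and the index is exhausted as well; the index is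
then restored. The run after the fact is the hypothesis `h`. -/
theorem exec_compareLoop_fact {v' : Reg} {s' : Store} {t : ℕ} (w : List Bool) (k : Fin 3)
    (r : List (Bool ⊕ Fin 3)) (u : List Bool) (v : Reg) (s : Store)
    (hw : s.saved.reverse ++ s.word = w)
    (h : Exec compareLoop
      { v with
        bit := none, sym := r.head?, eq := true
        found := if v.eq = true ∧ u = s.word then some k else v.found }
      { s with
        facts := r.tail, word := w, saved := []
        seen := Sum.inr k :: (u.map Sum.inl).reverse ++ s.seen } v' s' t) :
    Exec compareLoop { v with sym := (u.map Sum.inl ++ Sum.inr k :: r).head? }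
      { s with facts := (u.map Sum.inl ++ Sum.inr k :: r).tail } v' s'
      (t + (3 * w.length + 15) * (u.length + 1)) := by
  induction u generalizing v s with
  | nil =>
    obtain ⟨i, sc, _ | ⟨x, w'⟩, sa, fa, se, out⟩ := s
    · subst hw
      refine (Exec.loop_true rfl ((Exec.push.seq (Exec.pop.seq (Exec.load.seq
        ((Exec.cond_false rfl Exec.skip).seq (Exec.cond_true rfl (exec_restoreWord _ _)))))).seq
        Exec.pop) (?_ : Exec compareLoop _ _ v' s' t)).mono ?_
      · obtain ⟨_, _, _, _ | _, _, _, _, _, _⟩ := v <;> exact h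
      · simp [Store.set, Store.stk]
        omega
    · have hw' : (x :: sa).reverse ++ w' = w := by simpa using hw
      subst hw'
      refine (Exec.loop_true rfl ((Exec.push.seq (Exec.pop.seq (Exec.load.seq
        ((Exec.cond_true rfl Exec.push).seq (Exec.cond_true rfl ((exec_restoreWord _ _).mono
          (t' := 3 * (x :: sa).length + 2) (by exact le_rfl))))))).seq Exec.pop)
        (?_ : Exec compareLoop _ _ v' s' t)).mono ?_
      · obtain ⟨_, _, _, _ | _, _, _, _, _, _⟩ := v <;> exact h
      · simp
        omega
  | cons b u ih =>
    obtain ⟨i, sc, _ | ⟨x, w'⟩, sa, fa, se, out⟩ := s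
    -- The index ended before the fact did: the pop yields `none`, which differs from `some b` and
    -- spoils `eq`.
    · refine (Exec.loop_true rfl ((Exec.push.seq (Exec.pop.seq (Exec.load.seq
        ((Exec.cond_false rfl Exec.skip).seq (Exec.cond_false rfl Exec.skip))))).seq
        Exec.pop)
        (?_ : Exec compareLoop _ _ v' s' (t + (3 * w.length + 15) * (u.length + 1)))).mono ?_
      · refine ih { v with bit := none, eq := v.eq && none == some b }
          ⟨i, sc, [], sa, fa, .inl b :: se, out⟩ hw ?_
        simpa using h
      · simp only [List.length_cons]
        ring_nf
        omega
    · refine (Exec.loop_true rfl ((Exec.push.seq (Exec.pop.seq (Exec.load.seq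
        ((Exec.cond_true rfl Exec.push).seq (Exec.cond_false rfl Exec.skip))))).seq
        Exec.pop)
        (?_ : Exec compareLoop _ _ v' s' (t + (3 * w.length + 15) * (u.length + 1)))).mono ?_
      · refine ih { v with bit := some x, eq := v.eq && some x == some b }
          ⟨i, sc, w', x :: sa, fa, .inl b :: se, out⟩ (by simpa using hw) ?_
        simpa [and_assoc, eq_comm (a := b)] using h
      · simp only [List.length_cons]
        ring_nf
        omega

/-- A later match overwrites `found`, in accordance with `lookup`, which prefers the tail of the
list. -/
theorem exec_compareLoop (F : List Fact) (v : Reg) (s : Store) (hv : v.eq = true)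
    (hb : v.bit = none) (hs : s.saved = []) :
    Exec compareLoop { v with sym := (encodeFacts F).head? }
      { s with facts := (encodeFacts F).tail }
      { v with sym := none, found := (lookup s.word F).or v.found }
      { s with facts := [], seen := (encodeFacts F).reverse ++ s.seen }
      ((3 * s.word.length + 15) * factsSize F + 1) := by
  induction F generalizing v s with
  | nil => exact (Exec.loop_false rfl).mono (by omega)
  | cons p F ih =>
    have he : encodeFacts (p :: F) = p.1.map Sum.inl ++ Sum.inr p.2 :: encodeFacts F := by
      simp [encodeFacts]
    have hsize : factsSize (p :: F) = p.1.length + 1 + factsSize F := by simp [factsSize]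
    rw [he, hsize]
    have h := ih
      { v with
        sym := (encodeFacts F).head?
        found := if v.eq = true ∧ p.1 = s.word then some p.2 else v.found }
      { s with
        facts := (encodeFacts F).tail
        seen := Sum.inr p.2 :: (p.1.map Sum.inl).reverse ++ s.seen } hv hb hs
    refine ((exec_compareLoop_fact s.word p.2 (encodeFacts F) p.1 v s (by simp [hs])
      (h.congr ?_ ?_ rfl rfl)).mono ?_).congr rfl rfl ?_ ?_
    · simp [hv, hb]
    · simp [hs]
    · ring_nf
      omega
    · by_cases hp : p.1 = s.word <;> simp [hp, hv, lookup]
    · simp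

/-- The internal state between the phases of a scan. -/
def reg (letter : Option Letter) (found pend : Option (Fin 3)) (changed failed answer : Bool) :
    Reg :=
  ⟨letter, none, none, true, found, pend, changed, failed, answer⟩

theorem exec_findType (F : List Fact) (a : Option Letter) (pend : Option (Fin 3))
    (ch fl ans : Bool) (i sc : List Letter) (w out : List Bool) :
    Exec findType (reg a none pend ch fl ans) ⟨i, sc, w, [], encodeFacts F, [], out⟩
      (reg a (lookup w F) pend ch fl ans) ⟨i, sc, w, [], encodeFacts F, [], out⟩
      ((3 * w.length + 18) * factsSize F + 5) := by
  have h := exec_compareLoop F (reg a none pend ch fl ans) ⟨i, sc, w, [], encodeFacts F, [], out⟩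
    rfl rfl rfl
  have hr := exec_restoreFacts { reg a none pend ch fl ans with found := lookup w F }
    ⟨i, sc, w, [], [], (encodeFacts F).reverse, out⟩
  refine (Exec.load.seq ((Exec.pop.seq (h.congr rfl rfl rfl rfl)).seq
    (hr.congr ?_ ?_ ?_ ?_))).mono ?_
  · simp [reg]
  · simp
  · simp [reg]
  · simp
  · simp [length_encodeFacts]
    ring_nf
    omega

/-! #### Scanning the input -/

/-- Draw the conclusions from the type that was looked up. -/
def conclude (v : Reg) : Reg :=
  { v with
    found := none
    pend := match v.letter with
      | some (.glued σ) => v.found.map (quadImage σ)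
      | _ => none
    changed := v.changed || (v.pend.isSome && v.found.isNone)
    failed := v.failed || (v.pend.isSome && v.found.isSome && v.found != v.pend) }

/-- Process the current index. -/
def finishProg : Prog :=
  findType ;;
  .cond (fun v => v.pend.isSome && v.found.isNone)
    (.push .facts (fun v => .inr (v.pend.getD 0)) ;; saveWord ;; recordWord) .skip ;;
  .load conclude ;; clearWord

theorem exec_finishProg (st : ScanState) (a : Option Letter) (ans : Bool) (i sc : List Letter)
    (out : List Bool) :
    Exec finishProg (reg a none st.pend st.changed st.failed ans)
      ⟨i, sc, st.word, [], encodeFacts st.facts, [], out⟩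
      (reg a none (st.finish a).pend (st.finish a).changed (st.finish a).failed ans)
      ⟨i, sc, (st.finish a).word, [], encodeFacts (st.finish a).facts, [], out⟩
      ((3 * st.word.length + 18) * factsSize st.facts + 9 * st.word.length + 20) := by
  obtain ⟨w, pend, F, ch, fl⟩ := st
  have hfind := exec_findType F a pend ch fl ans i sc w out
  rcases pend with _ | k
  · refine (hfind.seq ((Exec.cond_false rfl Exec.skip).seq (Exec.load.seq
      ((exec_clearWord _ _).congr rfl rfl ?_ rfl)))).mono ?_
    · rfl
    · dsimp only
      omega
  · rcases h : lookup w F with _ | k'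
    · rw [h] at hfind
      -- A new fact: its type is pushed first, to lie below its bits. Moving the index through
      -- `saved` reverses it twice, so its order is kept.
      refine (hfind.seq ((Exec.cond_true rfl (Exec.push.seq ((exec_saveWord _ _).seq
        ((exec_recordWord _ _).mono (t' := 3 * w.length + 2) ?_)))).seq (Exec.load.seq
        ((exec_clearWord _ _).congr rfl rfl ?_ ?_)))).mono ?_
      · simp [Store.set, Store.stk]
      · simp [conclude, reg, ScanState.finish, h]
      · simp [Store.set, Store.stk, ScanState.finish, h, encodeFacts]
        rfl
      · simp [Store.set, Store.stk]
        omega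
    · rw [h] at hfind
      refine (hfind.seq ((Exec.cond_false rfl Exec.skip).seq (Exec.load.seq
        ((exec_clearWord _ _).congr rfl rfl ?_ ?_)))).mono ?_
      · simp [conclude, reg, ScanState.finish, h]
      · simp [ScanState.finish, h]
      · dsimp only
        omega

/-- Whether the letter that was read is a bit. -/
def isBit (v : Reg) : Bool :=
  match v.letter with
  | some (.bit _) => true
  | _ => false

/-- The bit that was read from the input. -/
def letterBit (v : Reg) : Bool :=
  match v.letter with
  | some (.bit b) => b
  | _ => false

/-- Process one letter of the input. -/
def scanBody : Prog :=
  .push .scanned (fun v => v.letter.getD .boundary) ;;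
  .cond isBit (.push .word letterBit) finishProg

/-- Scan the input. -/
def scanProg : Prog :=
  .load (fun v => { v with changed := false }) ;;
  drain .input setLetter (fun v => v.letter.isSome) scanBody ;; finishProg ;; restoreInput

theorem exec_scanBody (st : ScanState) (a : Letter) (ans : Bool) (i sc : List Letter)
    (out : List Bool) :
    Exec scanBody (reg (some a) none st.pend st.changed st.failed ans)
      ⟨i, sc, st.word, [], encodeFacts st.facts, [], out⟩
      (reg (some a) none (st.step a).pend (st.step a).changed (st.step a).failed ans)
      ⟨i, a :: sc, (st.step a).word, [], encodeFacts (st.step a).facts, [], out⟩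
      ((3 * st.word.length + 18) * factsSize st.facts + 9 * st.word.length + 22) := by
  cases a
  case bit b =>
    exact (Exec.push.seq (Exec.cond_true rfl Exec.push)).mono (by omega)
  all_goals
    exact (Exec.push.seq (Exec.cond_false rfl (exec_finishProg st _ ans i _ out))).mono (by omega)

/-- Each letter lengthens the current index by at most one bit and adds at most one fact, of size at
most `m + 1`. -/
theorem foldl_step_bounds (m : ℕ) (F : List Fact) (l : List Letter) (hl : l.length ≤ m) :
    (l.foldl ScanState.step ⟨[], none, F, false, false⟩).word.length ≤ l.length ∧
    factsSize (l.foldl ScanState.step ⟨[], none, F, false, false⟩).facts ≤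
      factsSize F + l.length * (m + 1) := by
  induction l using List.reverseRecOn with
  | nil => simp
  | append_singleton l a ih =>
    rw [List.length_append, List.length_singleton] at hl
    obtain ⟨h1, h2⟩ := ih (by omega)
    rw [List.foldl_append, List.foldl_cons, List.foldl_nil, List.length_append,
      List.length_singleton]
    refine ⟨(ScanState.word_length_step_le _ a).trans (by omega),
      (ScanState.factsSize_step_le _ a).trans ?_⟩
    rw [add_mul]
    omega

theorem factsSize_scan_le {m B : ℕ} {w : List Letter} {F : List Fact} (hw : w.length ≤ m)
    (hF : factsSize F ≤ B) : factsSize (scan w F).facts ≤ B + (m + 1) * (m + 1) := by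
  obtain ⟨h1, h2⟩ := foldl_step_bounds m F w hw
  refine (ScanState.factsSize_finish_le _ _).trans ?_
  have : w.length * (m + 1) ≤ m * (m + 1) := Nat.mul_le_mul_right _ hw
  rw [add_mul m]
  omega

/-- A bound for the time needed to process one letter of an input of length at most `m` when there
are at most `B` letters of facts before the scan. -/
def letterTime (m B : ℕ) : ℕ := (3 * m + 18) * (B + (m + 1) * (m + 1)) + 9 * m + 22

/-- A bound for the time of a scan. -/
def scanTime (m B : ℕ) : ℕ := (letterTime m B + 5) * (m + 2)

theorem exec_scanProg {m B : ℕ} {w : List Letter} {F : List Fact} (hw : w.length ≤ m)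
    (hF : factsSize F ≤ B) (ch ans : Bool) :
    Exec scanProg (reg none none none ch false ans) ⟨w, [], [], [], encodeFacts F, [], []⟩
      (reg none none none (scan w F).changed (scan w F).failed ans)
      ⟨w, [], [], [], encodeFacts (scan w F).facts, [], []⟩ (scanTime m B) := by
  -- The scan state after the letters `p`, listed last one first as they lie on the stack `scanned`.
  let st : List Letter → ScanState := fun p =>
    p.reverse.foldl ScanState.step ⟨[], none, F, false, false⟩
  have htime : ∀ p : List Letter, p.length ≤ m →
      (3 * (st p).word.length + 18) * factsSize (st p).facts + 9 * (st p).word.length + 22 ≤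
        letterTime m B := by
    intro p hp
    obtain ⟨h1, h2⟩ := foldl_step_bounds m F p.reverse (by simpa using hp)
    rw [List.length_reverse] at h1 h2
    have h3 : p.length * (m + 1) ≤ (m + 1) * (m + 1) := Nat.mul_le_mul_right _ (by omega)
    unfold letterTime
    gcongr ?_ * ?_ + 9 * ?_ + 22
    · change (st p).word.length ≤ _ at h1
      omega
    · change factsSize (st p).facts ≤ _ at h2
      omega
    · exact h1.trans hp
  have hstep : ∀ (p : List Letter) (a : Letter) (r : List Letter), p.reverse ++ a :: r = w →
      ∃ v', Exec scanBody (reg (some a) none (st p).pend (st p).changed (st p).failed ans)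
        ⟨r, p, (st p).word, [], encodeFacts (st p).facts, [], []⟩ v'
        ⟨r, a :: p, (st (a :: p)).word, [], encodeFacts (st (a :: p)).facts, [], []⟩
        (letterTime m B) ∧ setLetter v' r.head? =
          reg r.head? none (st (a :: p)).pend (st (a :: p)).changed (st (a :: p)).failed ans := by
    intro p a r hp
    have hst : st (a :: p) = (st p).step a := by
      simp only [st]
      rw [List.reverse_cons, List.foldl_append]
      rfl
    have hle : p.length ≤ m := by
      have := congrArg List.length hp
      simp only [List.length_append, List.length_reverse, List.length_cons] at this
      exact le_trans (by omega) hw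
    rw [hst]
    exact ⟨_, (exec_scanBody (st p) a ans r p []).mono (htime p hle), rfl⟩
  have hread := Exec.drain (k := .input) (f := setLetter) (b := fun v => v.letter.isSome)
    (body := scanBody) (c := letterTime m B) (v := reg none none none false false ans)
    (fun p r => reg r.head? none (st p).pend (st p).changed (st p).failed ans)
    (fun p r => ⟨r, p, (st p).word, [], encodeFacts (st p).facts, [], []⟩) w
    (fun _ _ => rfl) rfl (fun _ => rfl) (fun _ _ _ => rfl) hstep
  have hst : st w.reverse = w.foldl ScanState.step ⟨[], none, F, false, false⟩ := by
    simp [st]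
  have hfin := exec_finishProg (st w.reverse) none ans [] w.reverse []
  refine (Exec.load.seq ((hread.mono (Nat.add_le_add_right (Nat.mul_le_mul_left _ hw) 2)).seq
    ((hfin.mono (t' := letterTime m B)
    (le_trans (by omega) (htime w.reverse (by simpa using hw)))).seq
    ((exec_restoreInput _ _).congr rfl rfl ?_ ?_)))).mono ?_
  · rw [hst]
    rfl
  · rw [hst]
    simp [scan]
    rfl
  · have h1 : scanTime m B = (letterTime m B + 2) * m + 3 * m + letterTime m B * 2 + 10 := by
      rw [scanTime]
      ring
    rw [h1]
    simp only [List.length_reverse]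
    omega

/-! #### The main program -/

/-- Try the quadrilateral type `c` in the first tetrahedron. -/
def attempt (c : Fin 3) : Prog :=
  clearFacts ;; .push .facts (fun _ => .inr c) ;;
  .load (fun v => { v with changed := true }) ;;
  .loop (fun v => v.changed && !v.failed) scanProg ;;
  .load (fun v => { v with changed := false, failed := false, answer := v.answer || !v.failed })

/-- The program of the machine. -/
def main : Prog :=
  attempt 0 ;; attempt 1 ;; attempt 2 ;; clearInput ;; clearFacts ;;
  .push .output (fun v => v.answer) ;; .load fun _ => reg none none none false false false

theorem exec_loop_scanProg {m B : ℕ} {w : List Letter} (hw : w.length ≤ m) {F : List Fact}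
    {st : ScanState} {r : ℕ} (h : Converges w B F st r) (ans : Bool) :
    Exec (.loop (fun v => v.changed && !v.failed) scanProg) (reg none none none true false ans)
      ⟨w, [], [], [], encodeFacts F, [], []⟩ (reg none none none st.changed st.failed ans)
      ⟨w, [], [], [], encodeFacts st.facts, [], []⟩ (r * (scanTime m B + 1) + 1) := by
  induction h with
  | @last F hF hb =>
    refine (Exec.loop_true rfl (exec_scanProg hw hF true ans) (Exec.loop_false hb)).mono ?_
    omega
  | @next F st r hF hb _ ih =>
    obtain ⟨h1, h2⟩ := (Bool.and_eq_true_iff).1 hb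
    have h := exec_scanProg hw hF true ans
    rw [h1, show (scan w F).failed = false by simpa using h2] at h
    refine (Exec.loop_true rfl h ih).mono ?_
    ring_nf
    omega

/-- This bounds the cost of erasing the facts that an attempt leaves behind. -/
theorem factsSize_le_of_converges {m B : ℕ} {w : List Letter} (hw : w.length ≤ m) {F : List Fact}
    {st : ScanState} {r : ℕ} (h : Converges w B F st r) :
    factsSize st.facts ≤ B + (m + 1) * (m + 1) := by
  induction h with
  | last hF _ => exact factsSize_scan_le hw hF
  | next _ _ _ ih => exact ih

theorem exec_attempt {m B : ℕ} {w : List Letter} (hw : w.length ≤ m) {c : Fin 3} {G : List Fact}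
    {st : ScanState} {r : ℕ} (hG : factsSize G ≤ B + (m + 1) * (m + 1))
    (h : Converges w B [([], c)] st r) (ans : Bool) :
    Exec (attempt c) (reg none none none false false ans)
      ⟨w, [], [], [], encodeFacts G, [], []⟩
      (reg none none none false false (ans || !st.failed))
      ⟨w, [], [], [], encodeFacts st.facts, [], []⟩
      (3 * (B + (m + 1) * (m + 1)) + r * (scanTime m B + 1) + 6) := by
  -- One pushed symbol is the whole fact `([], c)`, as its index has no bits.
  refine ((exec_clearFacts _ _).seq (Exec.push.seq (Exec.load.seq
    ((exec_loop_scanProg hw h ans).seq Exec.load)))).mono ?_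
  simp only [length_encodeFacts]
  omega

end SplittingMachine

namespace SplittingMachine

open Triangulation Tet StackProg

/-- The final clean-up is needed because `Turing.haltList` prescribes the initial internal state and
empty stacks apart from the output. -/
theorem exec_main {m B N : ℕ} {w : List Letter} (hw : w.length ≤ m) {st : Fin 3 → ScanState}
    {r : Fin 3 → ℕ} (hr : ∀ c, r c ≤ N) (h : ∀ c, Converges w B [([], c)] (st c) (r c)) :
    Exec main (reg none none none false false false) ⟨w, [], [], [], [], [], []⟩
      (reg none none none false false false)
      ⟨[], [], [], [], [], [], [!(st 0).failed || !(st 1).failed || !(st 2).failed]⟩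
      (3 * (3 * (B + (m + 1) * (m + 1)) + N * (scanTime m B + 1) + 6) + 3 * m +
        3 * (B + (m + 1) * (m + 1)) + 6) := by
  have hfacts := fun c => factsSize_le_of_converges hw (h c)
  have h0 := exec_attempt hw (G := []) (Nat.zero_le _) (h 0) false
  have h1 := exec_attempt hw (hfacts 0) (h 1) (false || !(st 0).failed)
  have h2 := exec_attempt hw (hfacts 1) (h 2) ((false || !(st 0).failed) || !(st 1).failed)
  refine (h0.seq (h1.seq (h2.seq ((exec_clearInput _ _).seq ((exec_clearFacts _ _).seq
    (Exec.push.seq Exec.load)))))).mono ?_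
  have a0 := Nat.mul_le_mul_right (scanTime m B + 1) (hr 0)
  have a1 := Nat.mul_le_mul_right (scanTime m B + 1) (hr 1)
  have a2 := Nat.mul_le_mul_right (scanTime m B + 1) (hr 2)
  have a3 := hfacts 2
  simp only [length_encodeFacts]
  omega

/-- The Turing machine that recognises the triangulations that contain a splitting surface. -/
noncomputable def splittingMachine : Turing.TM2ComputableAux Letter Bool where
  tm :=
    { k₀ := Stack.input
      k₁ := Stack.output
      Γ := Alphabet
      Λ := Option main.Label
      main := some main.entry
      ΛFin := inferInstance
      σ := Reg
      initialState := reg none none none false false false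
      Γk₀Fin := inferInstanceAs (Fintype Letter)
      m := main.machine }
  inputAlphabet := Equiv.refl Letter
  outputAlphabet := Equiv.refl Bool

/-- A bound for the running time on triangulations with `n` tetrahedra. -/
noncomputable def timeBound : Polynomial ℕ :=
  let n : Polynomial ℕ := .X
  let m := n * 4 * (2 * n + 2)
  let B := n * (n + 1)
  let C := B + (m + 1) * (m + 1)
  let letter := (3 * m + 18) * C + 9 * m + 22
  let scan := (letter + 5) * (m + 2)
  3 * (3 * C + (n + 1) * (scan + 1) + 6) + 3 * m + 3 * C + 7

/-- The bound of `exec_main` with `N = n + 1` scans per attempt, where 7 replaces 6 to pay for the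
halting step. -/
theorem eval_timeBound (n m B : ℕ) (hm : m = n * 4 * (2 * n + 2)) (hB : B = n * (n + 1)) :
    timeBound.eval n =
      3 * (3 * (B + (m + 1) * (m + 1)) + (n + 1) * (scanTime m B + 1) + 6) + 3 * m +
        3 * (B + (m + 1) * (m + 1)) + 7 := by
  subst hm hB
  simp [timeBound, scanTime, letterTime]

/-- The machine decides within the time bound whether there is a matching choice of quadrilateral
types. -/
theorem splittingMachine_outputs (T : Triangulation) : ∃ answer : Bool,
    (answer = true ↔ ∃ col, T.IsQuadColouring col) ∧
    Nonempty (Turing.TM2OutputsInTime splittingMachine.tm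
      (T.encode.map splittingMachine.inputAlphabet.symm)
      (some ((Computability.encodeBool answer).map splittingMachine.outputAlphabet.symm))
      (timeBound.eval T.n)) := by
  have hw := T.length_encode_le
  have hconv := fun c => exists_converges T.n (T.isPartialColouring_singleton c) (by omega)
  choose st r hst hr hcol using hconv
  refine ⟨!(st 0).failed || !(st 1).failed || !(st 2).failed, ?_, ?_⟩
  · have hc : ∀ c, (!(st c).failed) = true ↔
        ∃ col, T.IsQuadColouring col ∧ col ⟨0, T.n_pos⟩ = c := fun c => by
      rw [Bool.not_eq_true', hcol]
    rw [Bool.or_eq_true, Bool.or_eq_true, hc, hc, hc]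
    constructor
    · rintro ((⟨col, h, -⟩ | ⟨col, h, -⟩) | ⟨col, h, -⟩) <;> exact ⟨col, h⟩
    · rintro ⟨col, h⟩
      have : ∀ x : Fin 3, (x = 0 ∨ x = 1) ∨ x = 2 := by decide
      exact (this (col ⟨0, T.n_pos⟩)).imp (.imp (⟨col, h, ·⟩) (⟨col, h, ·⟩)) (⟨col, h, ·⟩)
  · obtain ⟨t, ht, e⟩ := Runs.machine_reachesWithin (exec_main hw hr hst)
    refine ⟨⟨⟨t, ?_⟩, ht.trans ?_⟩⟩
    · have hin : Turing.initList splittingMachine.tm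
          (T.encode.map splittingMachine.inputAlphabet.symm) =
          ⟨some (some main.entry), reg none none none false false false,
            Store.stk ⟨T.encode, [], [], [], [], [], []⟩⟩ := by
        rw [show T.encode.map splittingMachine.inputAlphabet.symm = T.encode from List.map_id _]
        refine congrArg (Turing.TM2.Cfg.mk _ _) ?_
        funext k
        cases k <;> rfl
      have hout : ∀ b : Bool, Turing.haltList splittingMachine.tm
          ((Computability.encodeBool b).map splittingMachine.outputAlphabet.symm) =
          ⟨none, reg none none none false false false,
            Store.stk ⟨[], [], [], [], [], [], [b]⟩⟩ := fun b => by
        refine congrArg (Turing.TM2.Cfg.mk _ _) ?_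
        funext k
        cases k <;> rfl
      rw [Option.map_some, hin, hout]
      exact e
    · rw [eval_timeBound _ _ _ rfl rfl]

end SplittingMachine

/-- There are one Turing machine (Mathlib's multi-stack model, with finitely many stacks, labels
and internal states) and one polynomial `p` such that, on input any triangulation with `n`
tetrahedra, the machine halts after at most `p n` steps and outputs whether the triangulation
contains a splitting surface. -/
theorem theorem4p2 :
    ∃ (M : Turing.TM2ComputableAux Triangulation.Letter Bool) (p : Polynomial ℕ),
      ∀ T : Triangulation, ∃ answer : Bool,
        (answer = true ↔ ∃ S : Set T.Space, T.IsSplittingSurface S) ∧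
        Nonempty (Turing.TM2OutputsInTime M.tm
          (T.encode.map M.inputAlphabet.symm)
          (some ((Computability.encodeBool answer).map M.outputAlphabet.symm))
          (p.eval T.n)) := by
  refine ⟨SplittingMachine.splittingMachine, SplittingMachine.timeBound, fun T => ?_⟩
  rw [Triangulation.exists_isSplittingSurface_iff]
  exact SplittingMachine.splittingMachine_outputs T
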